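/- Let $N\ge 1$, let $1<p<\infty$, let $\Omega\subset\mathbb R^N$ be a bounded open set, and let $Q=(0,1)^N$ be the unit cube. Let $g\in L^\infty(\mathbb R^N)$ be a $Q$-periodic function (that is, $g(x+e_i)=g(x)$ for a.e. $x$ and every coordinate vector $e_i$) such that $0<g^-\le g\le g^+<\infty$ a.e. for some constants $g^-,g^+$, and let $\bar g=\int_Q g(x)\,dx$ be its average over $Q$. Then, for every $\varepsilon>0$ and every $u\in W^{1,p}_0(\Omega)$, $$ \Big|\int_\Omega \big(g(\tfrac{x}{\varepsilon})-\bar g\big)\,|u(x)|^p\,dx\Big|\le p\,c_1\,\|g-\bar g\|_{L^\infty(\mathbb R^N)}\,\varepsilon\,\|u\|_{L^p(\Omega)}^{p-1}\,\|\nabla u\|_{L^p(\Omega)} . $$ Here $c_1$ is the optimal constant in Poincaré's inequality in $L^1(Q)$, that is, the infimum of all $c\ge 0$ such that $\|v-\int_Q v\|_{L^1(Q)}\le c\,\|\nabla v\|_{L^1(Q)}$ for every $v\in W^{1,1}(Q)$. -/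

import Mathlib

open MeasureTheory Filter Topology
open scoped ENNReal ContDiff

noncomputable section

namespace PeriodicSobolev

/-- `φ` is a test function on `Ω`, i.e. an element of `C_c^∞(Ω)`. -/
def IsTestFunction {N : ℕ} (Ω : Set (EuclideanSpace ℝ (Fin N)))
    (φ : EuclideanSpace ℝ (Fin N) → ℝ) : Prop :=
  ContDiff ℝ ∞ φ ∧ HasCompactSupport φ ∧ tsupport φ ⊆ Ω

/-- `G` is the weak (distributional) gradient of `u` on the open set `Ω`:
`∫_Ω u ∂_v φ = - ∫_Ω φ ⟨G, v⟩` for all test functions `φ` and all directions `v`. -/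
def HasWeakGradient {N : ℕ} (Ω : Set (EuclideanSpace ℝ (Fin N)))
    (u : EuclideanSpace ℝ (Fin N) → ℝ)
    (G : EuclideanSpace ℝ (Fin N) → EuclideanSpace ℝ (Fin N)) : Prop :=
  LocallyIntegrableOn u Ω volume ∧ LocallyIntegrableOn G Ω volume ∧
    ∀ φ : EuclideanSpace ℝ (Fin N) → ℝ, IsTestFunction Ω φ →
      ∀ v : EuclideanSpace ℝ (Fin N),
        ∫ x in Ω, u x * fderiv ℝ φ x v = - ∫ x in Ω, φ x * inner ℝ (G x) v

/-- `u ∈ W^{1,p}(Ω)`. -/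
def MemW1p {N : ℕ} (Ω : Set (EuclideanSpace ℝ (Fin N))) (p : ℝ≥0∞)
    (u : EuclideanSpace ℝ (Fin N) → ℝ) : Prop :=
  MemLp u p (volume.restrict Ω) ∧
    ∃ G : EuclideanSpace ℝ (Fin N) → EuclideanSpace ℝ (Fin N),
      HasWeakGradient Ω u G ∧ MemLp G p (volume.restrict Ω)

/-- `u ∈ W^{1,p}_0(Ω)`: `u` belongs to `W^{1,p}(Ω)` and is the limit, in the norm of
`W^{1,p}(Ω)`, of a sequence of test functions on `Ω`. -/
def MemW1pZero {N : ℕ} (Ω : Set (EuclideanSpace ℝ (Fin N))) (p : ℝ≥0∞)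
    (u : EuclideanSpace ℝ (Fin N) → ℝ) : Prop :=
  MemLp u p (volume.restrict Ω) ∧
    ∃ G : EuclideanSpace ℝ (Fin N) → EuclideanSpace ℝ (Fin N),
      HasWeakGradient Ω u G ∧ MemLp G p (volume.restrict Ω) ∧
      ∃ φ : ℕ → EuclideanSpace ℝ (Fin N) → ℝ,
        (∀ n, IsTestFunction Ω (φ n)) ∧
        Tendsto (fun n => eLpNorm (fun x => φ n x - u x) p (volume.restrict Ω)) atTop (𝓝 0) ∧
        Tendsto (fun n => eLpNorm (fun x => gradient (φ n) x - G x) p (volume.restrict Ω))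
          atTop (𝓝 0)

/-- The (open) unit cube `Q = (0,1)^N`. -/
def unitCube (N : ℕ) : Set (EuclideanSpace ℝ (Fin N)) :=
  {x | ∀ i, x i ∈ Set.Ioo (0 : ℝ) 1}

/-- The average of `f` over the unit cube (which has volume `1`). -/
def cubeAverage {N : ℕ} (f : EuclideanSpace ℝ (Fin N) → ℝ) : ℝ :=
  ∫ x in unitCube N, f x

/-- `c` is an admissible constant in Poincaré's inequality in `L^1(Q)`:
`‖u - (u)_Q‖_{L^1(Q)} ≤ c ‖∇u‖_{L^1(Q)}` for every `u ∈ W^{1,1}(Q)`. -/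
def IsPoincareConstant (N : ℕ) (c : ℝ) : Prop :=
  0 ≤ c ∧ ∀ (u : EuclideanSpace ℝ (Fin N) → ℝ)
    (G : EuclideanSpace ℝ (Fin N) → EuclideanSpace ℝ (Fin N)),
    MemW1p (unitCube N) 1 u → HasWeakGradient (unitCube N) u G →
      lpNorm (fun x => u x - cubeAverage u) 1 (volume.restrict (unitCube N)) ≤
        c * lpNorm G 1 (volume.restrict (unitCube N))

/-- `c_1`, the optimal constant in Poincaré's inequality in `L^1(Q)`. -/
def poincareConstant (N : ℕ) : ℝ :=
  sInf {c : ℝ | IsPoincareConstant N c}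

/-- `g` is `Q`-periodic, i.e. has period `1` in each coordinate direction
(up to null sets, `g` being a Lebesgue measurable function). -/
def IsCubePeriodic {N : ℕ} (g : EuclideanSpace ℝ (Fin N) → ℝ) : Prop :=
  ∀ i : Fin N, ∀ᵐ x : EuclideanSpace ℝ (Fin N), g (x + EuclideanSpace.single i 1) = g x

end PeriodicSobolev

end

/-! Write `a = g - cubeAverage g`: bounded, periodic, of mean zero on the cube. For a test function
`φ` and `p > 1`, `w = |φ|^p` is `C^1` with compact support. After rescaling by `ε`, space is tiled
by integer translates of the cube. On each tile the mean of `w` may be subtracted for free, so the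
L¹ Poincaré inequality bounds `∫ a w` by `‖a‖_∞ c₁ ∫ |∇w|`. Summing over tiles and scaling back
gives `abs_integral_rescaled_periodic_mul_le`, with one factor `ε` left over from the gradient. Then
`|∇w| ≤ p |φ|^(p-1) |∇φ|` and Hölder's inequality give the estimate for `φ`, and density gives it
for `u`.

Since `c₁` is an infimum over a set of reals, it must be shown that some Poincaré constant exists
and that the infimum is attained. Existence comes from integrating the gradient along segments of a
convex set, for mollified functions on smaller cubes, followed by Fatou's lemma. -/

noncomputable section

namespace PeriodicSobolev

/-! ### Differences of a smooth function over a convex set -/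

section Segment

variable {E : Type*} [NormedAddCommGroup E] [NormedSpace ℝ E] [MeasurableSpace E] [BorelSpace E]
  [FiniteDimensional ℝ E]

theorem lintegral_comp_add_smul_le (μ : Measure E) [μ.IsAddHaarMeasure] {h : E → ℝ≥0∞}
    (hh : Measurable h) (z : E) {t : ℝ} (ht : 1 / 2 ≤ t) :
    ∫⁻ x, h (z + t • x) ∂μ ≤ 2 ^ Module.finrank ℝ E * ∫⁻ x, h x ∂μ := by
  have ht0 : t ≠ 0 := by linarith
  have h1 : ∫⁻ x, h (z + t • x) ∂μ
      = ENNReal.ofReal |(t ^ Module.finrank ℝ E)⁻¹| * ∫⁻ x, h x ∂μ := by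
    rw [← lintegral_add_left_eq_self h z, ← smul_eq_mul, ← lintegral_smul_measure,
      ← Measure.map_addHaar_smul μ ht0, lintegral_map (by fun_prop) (by fun_prop)]
  rw [h1]
  gcongr
  rw [abs_of_nonneg (by positivity), ← ENNReal.ofReal_ofNat 2, ← ENNReal.ofReal_pow (by norm_num),
    ← inv_pow]
  gcongr
  rw [inv_le_comm₀ (by linarith) (by norm_num)]
  linarith

/-- One of the weights `t`, `1 - t` is at least `1/2`. Integrating first in the variable carrying it
keeps the Jacobian bounded uniformly in `t`. -/
theorem lintegral_lintegral_segment_le (μ : Measure E) [μ.IsAddHaarMeasure] {h : E → ℝ≥0∞}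
    (hh : Measurable h) (K : Set E) (t : ℝ) :
    ∫⁻ x in K, ∫⁻ y in K, h (y + t • (x - y)) ∂μ ∂μ
      ≤ 2 ^ Module.finrank ℝ E * μ K * ∫⁻ x, h x ∂μ := by
  have key : ∀ s : ℝ, 1 / 2 ≤ s → ∫⁻ x in K, ∫⁻ y in K, h ((1 - s) • x + s • y) ∂μ ∂μ
      ≤ 2 ^ Module.finrank ℝ E * μ K * ∫⁻ x, h x ∂μ := fun s hs => by
    calc ∫⁻ x in K, ∫⁻ y in K, h ((1 - s) • x + s • y) ∂μ ∂μ
        ≤ ∫⁻ x in K, 2 ^ Module.finrank ℝ E * ∫⁻ x, h x ∂μ ∂μ :=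
          lintegral_mono fun x => (setLIntegral_le_lintegral _ _).trans
            (lintegral_comp_add_smul_le μ hh _ hs)
      _ = _ := by rw [setLIntegral_const]; ring
  rcases le_total (1 / 2) t with ht | ht
  -- Here the large weight sits on `x`, so `x` becomes the inner variable.
  · rw [lintegral_lintegral_swap (by fun_prop)]
    convert key t ht using 6 with x y
    module
  · convert key (1 - t) (by linarith) using 6 with x y
    module

theorem enorm_sub_le_lintegral_fderiv {E : Type*} [NormedAddCommGroup E] [NormedSpace ℝ E]
    {f : E → ℝ} (hf : ContDiff ℝ 1 f) (x y : E) :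
    ‖f x - f y‖ₑ ≤ ∫⁻ t in Set.Icc (0 : ℝ) 1, ‖fderiv ℝ f (y + t • (x - y))‖ₑ * ‖x - y‖ₑ := by
  set c : ℝ → ℝ := fun t => f (y + t • (x - y)) with hc
  have hcd : ContDiff ℝ 1 c := by fun_prop
  have h := enorm_sub_le_lintegral_deriv_of_contDiffOn_Icc (f := c) (a := 0) (b := 1)
    hcd.contDiffOn zero_le_one
  have e : f x - f y = c 1 - c 0 := by simp [hc]
  rw [e]
  refine h.trans (lintegral_mono fun t => ?_)
  have hd : HasDerivAt c (fderiv ℝ f (y + t • (x - y)) (x - y)) t := by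
    have h1 : HasDerivAt (fun t : ℝ => y + t • (x - y)) (x - y) t := by
      simpa using ((hasDerivAt_id t).smul_const (x - y)).const_add y
    exact (hf.differentiable one_ne_zero _).hasFDerivAt.comp_hasDerivAt t h1
  rw [hd.deriv]
  exact ContinuousLinearMap.le_opENorm _ _

theorem lintegral_lintegral_enorm_sub_le_of_contDiff (μ : Measure E) [μ.IsAddHaarMeasure]
    {f : E → ℝ} (hf : ContDiff ℝ 1 f) {K : Set E} (hK : Convex ℝ K) (hKm : MeasurableSet K) :
    ∫⁻ x in K, ∫⁻ y in K, ‖f x - f y‖ₑ ∂μ ∂μ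
      ≤ 2 ^ Module.finrank ℝ E * μ K * Metric.ediam K * ∫⁻ x in K, ‖fderiv ℝ f x‖ₑ ∂μ := by
  -- Extension by zero allows changes of variables on the whole space; by convexity it loses nothing
  -- on segments with endpoints in `K`.
  set h : E → ℝ≥0∞ := K.indicator fun x => ‖fderiv ℝ f x‖ₑ with hh
  have hm : Measurable h :=
    ((hf.continuous_fderiv one_ne_zero).enorm.measurable).indicator hKm
  have hint : ∫⁻ x, h x ∂μ = ∫⁻ x in K, ‖fderiv ℝ f x‖ₑ ∂μ := lintegral_indicator hKm _
  have hpt : ∀ x ∈ K, ∀ y ∈ K, ‖f x - f y‖ₑ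
      ≤ ∫⁻ t in Set.Icc (0 : ℝ) 1, Metric.ediam K * h (y + t • (x - y)) := fun x hx y hy => by
    refine (enorm_sub_le_lintegral_fderiv hf x y).trans
      (setLIntegral_mono' measurableSet_Icc fun t ht => ?_)
    have hmem : y + t • (x - y) ∈ K := hK.add_smul_sub_mem hy hx ht
    rw [hh, Set.indicator_of_mem hmem, mul_comm]
    gcongr
    rw [← edist_eq_enorm_sub]
    exact Metric.edist_le_ediam_of_mem hx hy
  calc ∫⁻ x in K, ∫⁻ y in K, ‖f x - f y‖ₑ ∂μ ∂μ
      ≤ ∫⁻ x in K, ∫⁻ y in K,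
          ∫⁻ t in Set.Icc (0 : ℝ) 1, Metric.ediam K * h (y + t • (x - y)) ∂volume ∂μ ∂μ :=
        setLIntegral_mono' hKm fun x hx => setLIntegral_mono' hKm fun y hy => hpt x hx y hy
    _ = ∫⁻ x in K, ∫⁻ t in Set.Icc (0 : ℝ) 1, ∫⁻ y in K,
          Metric.ediam K * h (y + t • (x - y)) ∂μ ∂volume ∂μ := by
        refine lintegral_congr fun x => lintegral_lintegral_swap ?_
        exact Measurable.aemeasurable (by fun_prop)
    _ = ∫⁻ t in Set.Icc (0 : ℝ) 1, ∫⁻ x in K, ∫⁻ y in K,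
          Metric.ediam K * h (y + t • (x - y)) ∂μ ∂μ := by
        refine lintegral_lintegral_swap (Measurable.aemeasurable ?_)
        refine Measurable.lintegral_prod_right' (f := fun q : (E × ℝ) × E =>
          Metric.ediam K * h (q.2 + q.1.2 • (q.1.1 - q.2))) ?_
        fun_prop
    _ ≤ ∫⁻ t in Set.Icc (0 : ℝ) 1,
          Metric.ediam K * (2 ^ Module.finrank ℝ E * μ K * ∫⁻ x, h x ∂μ) := by
        refine lintegral_mono fun t => ?_
        calc ∫⁻ x in K, ∫⁻ y in K, Metric.ediam K * h (y + t • (x - y)) ∂μ ∂μ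
            = Metric.ediam K * ∫⁻ x in K, ∫⁻ y in K, h (y + t • (x - y)) ∂μ ∂μ := by
              rw [← lintegral_const_mul]
              · exact lintegral_congr fun x => lintegral_const_mul _ (by fun_prop)
              · refine Measurable.lintegral_prod_right' (f := fun q : E × E =>
                  h (q.2 + t • (q.1 - q.2))) ?_
                fun_prop
          _ ≤ _ := by gcongr; exact lintegral_lintegral_segment_le μ hm K t
    _ = _ := by
        rw [setLIntegral_const, hint]
        simp
        ring

end Segment

/-! ### The unit cube and its concentric subcubes -/

section Cube

variable {N : ℕ}

theorem unitCube_eq_preimage (N : ℕ) :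
    unitCube N = WithLp.ofLp ⁻¹' (Set.univ.pi fun _ : Fin N => Set.Ioo (0 : ℝ) 1) := by
  ext x; simp [unitCube]

theorem isOpen_unitCube (N : ℕ) : IsOpen (unitCube N) := by
  rw [unitCube_eq_preimage]
  exact (isOpen_set_pi Set.finite_univ fun _ _ => isOpen_Ioo).preimage
    (PiLp.continuous_ofLp 2 _)

theorem volume_unitCube (N : ℕ) : volume (unitCube N) = 1 := by
  rw [unitCube_eq_preimage, (PiLp.volume_preserving_ofLp (Fin N)).measure_preimage
    (MeasurableSet.univ_pi fun _ => measurableSet_Ioo).nullMeasurableSet, Real.volume_pi_Ioo]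
  simp

instance : IsProbabilityMeasure (volume.restrict (unitCube N)) :=
  ⟨by rw [Measure.restrict_apply_univ, volume_unitCube]⟩

theorem isBounded_unitCube (N : ℕ) : Bornology.IsBounded (unitCube N) := by
  refine (Metric.isBounded_iff_subset_closedBall 0).2 ⟨√N, fun x hx => ?_⟩
  rw [mem_closedBall_zero_iff, EuclideanSpace.norm_eq]
  refine Real.sqrt_le_sqrt ?_
  calc ∑ i, ‖x i‖ ^ 2 ≤ ∑ _i : Fin N, (1 : ℝ) := by
        refine Finset.sum_le_sum fun i _ => ?_
        rw [Real.norm_eq_abs, sq_abs]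
        nlinarith [(hx i).1, (hx i).2]
    _ = N := by simp

/-- The concentric subcube `(δ, 1 - δ)^N` of the unit cube. -/
def innerCube (N : ℕ) (δ : ℝ) : Set (EuclideanSpace ℝ (Fin N)) :=
  {x | ∀ i, x i ∈ Set.Ioo δ (1 - δ)}

theorem convex_innerCube (N : ℕ) (δ : ℝ) : Convex ℝ (innerCube N δ) := by
  have : innerCube N δ
      = ⋂ i, (EuclideanSpace.proj (𝕜 := ℝ) i).toLinearMap ⁻¹' (Set.Ioo δ (1 - δ)) := by
    ext x; simp [innerCube]
  rw [this]
  exact convex_iInter fun i => (convex_Ioo _ _).linear_preimage _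

theorem isOpen_innerCube (N : ℕ) (δ : ℝ) : IsOpen (innerCube N δ) := by
  have : innerCube N δ = ⋂ i, (fun x : EuclideanSpace ℝ (Fin N) => x i) ⁻¹' (Set.Ioo δ (1 - δ)) := by
    ext x; simp [innerCube]
  rw [this]
  exact isOpen_iInter_of_finite fun i => isOpen_Ioo.preimage (by fun_prop)

theorem innerCube_subset_unitCube {δ : ℝ} (hδ : 0 ≤ δ) : innerCube N δ ⊆ unitCube N :=
  fun x hx i => ⟨by linarith [(hx i).1], by linarith [(hx i).2]⟩

theorem closedBall_subset_unitCube {δ : ℝ} {x : EuclideanSpace ℝ (Fin N)}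
    (hx : x ∈ innerCube N δ) : Metric.closedBall x δ ⊆ unitCube N := fun y hy i => by
  have h1 : |y i - x i| ≤ δ := by
    have := (PiLp.norm_apply_le (y - x) i).trans (mem_closedBall_iff_norm.1 hy)
    simpa using this
  have h2 := abs_le.1 h1
  have h3 := hx i
  exact ⟨by linarith [h3.1], by linarith [h3.2]⟩

theorem eventually_mem_innerCube {x : EuclideanSpace ℝ (Fin N)} (hx : x ∈ unitCube N)
    {δ : ℕ → ℝ} (hδ : Tendsto δ atTop (𝓝 0)) : ∀ᶠ n in atTop, x ∈ innerCube N (δ n) := by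
  refine eventually_all.2 fun i => ?_
  filter_upwards [hδ.eventually_lt_const (hx i).1,
    hδ.eventually_lt_const (show (0 : ℝ) < 1 - x i by linarith [(hx i).2])] with n h1 h2
  exact ⟨h1, by linarith⟩

end Cube


/-! ### Weak gradients: uniqueness and mollification -/

section WeakGradient

variable {N : ℕ} {Ω : Set (EuclideanSpace ℝ (Fin N))}

theorem IsTestFunction.eq_zero_of_notMem {φ : EuclideanSpace ℝ (Fin N) → ℝ}
    (hφ : IsTestFunction Ω φ) {x : EuclideanSpace ℝ (Fin N)} (hx : x ∉ Ω) : φ x = 0 :=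
  image_eq_zero_of_notMem_tsupport fun h => hx (hφ.2.2 h)

theorem IsTestFunction.integrable_smul {F : Type*} [NormedAddCommGroup F] [NormedSpace ℝ F]
    {φ : EuclideanSpace ℝ (Fin N) → ℝ} (hφ : IsTestFunction Ω φ)
    {G : EuclideanSpace ℝ (Fin N) → F} (hG : LocallyIntegrableOn G Ω volume) :
    Integrable (fun x => φ x • G x) := by
  have h1 : IntegrableOn G (tsupport φ) := hG.integrableOn_compact_subset hφ.2.2 hφ.2.1
  have h2 : IntegrableOn (fun x => φ x • G x) (tsupport φ) :=
    h1.continuousOn_smul hφ.1.continuous.continuousOn hφ.2.1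
  refine (integrableOn_iff_integrable_of_support_subset fun x hx => ?_).1 h2
  refine subset_tsupport _ fun h0 => hx ?_
  simp [h0]

theorem IsTestFunction.setIntegral_eq {F : Type*} [NormedAddCommGroup F] [NormedSpace ℝ F]
    {φ : EuclideanSpace ℝ (Fin N) → ℝ} (hφ : IsTestFunction Ω φ)
    (G : EuclideanSpace ℝ (Fin N) → F) : ∫ x in Ω, φ x • G x = ∫ x, φ x • G x :=
  setIntegral_eq_integral_of_forall_compl_eq_zero fun x hx => by
    rw [hφ.eq_zero_of_notMem hx, zero_smul]

theorem setIntegral_testFunction_mul_inner {u : EuclideanSpace ℝ (Fin N) → ℝ}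
    {G : EuclideanSpace ℝ (Fin N) → EuclideanSpace ℝ (Fin N)} (h : HasWeakGradient Ω u G)
    {φ : EuclideanSpace ℝ (Fin N) → ℝ} (hφ : IsTestFunction Ω φ) (v : EuclideanSpace ℝ (Fin N)) :
    inner ℝ v (∫ x in Ω, φ x • G x) = - ∫ x in Ω, u x * fderiv ℝ φ x v := by
  rw [h.2.2 φ hφ v, neg_neg, ← integral_inner (hφ.integrable_smul h.2.1).integrableOn]
  refine integral_congr_ae (.of_forall fun x => ?_)
  simp only [inner_smul_right, real_inner_comm]

/-- Fundamental lemma of the calculus of variations, applied to the difference of the two gradients.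
-/
theorem HasWeakGradient.ae_eq (hΩ : IsOpen Ω) {u : EuclideanSpace ℝ (Fin N) → ℝ}
    {G G' : EuclideanSpace ℝ (Fin N) → EuclideanSpace ℝ (Fin N)}
    (h : HasWeakGradient Ω u G) (h' : HasWeakGradient Ω u G') :
    G =ᵐ[volume.restrict Ω] G' := by
  have key := hΩ.ae_eq_zero_of_integral_contDiff_smul_eq_zero (h.2.1.sub h'.2.1)
    fun φ h1 h2 h3 => by
      have hφ : IsTestFunction Ω φ := ⟨h1, h2, h3⟩
      simp only [Pi.sub_apply, smul_sub]
      rw [integral_sub (hφ.integrable_smul h.2.1) (hφ.integrable_smul h'.2.1), sub_eq_zero,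
        ← hφ.setIntegral_eq, ← hφ.setIntegral_eq]
      refine ext_inner_left ℝ fun v => ?_
      rw [setIntegral_testFunction_mul_inner h hφ, setIntegral_testFunction_mul_inner h' hφ]
  filter_upwards [(ae_restrict_iff' hΩ.measurableSet).2 key] with x hx
  exact sub_eq_zero.1 hx

theorem fderiv_convolution_normed_apply {U : EuclideanSpace ℝ (Fin N) → ℝ}
    (hU : LocallyIntegrable U) (η : ContDiffBump (0 : EuclideanSpace ℝ (Fin N)))
    (x v : EuclideanSpace ℝ (Fin N)) :
    fderiv ℝ (convolution (η.normed volume) U (ContinuousLinearMap.lsmul ℝ ℝ) volume) x v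
      = ∫ t, fderiv ℝ (η.normed volume) (x - t) v * U t := by
  have hη1 : ContDiff ℝ 1 (η.normed volume) := η.contDiff_normed
  have hηc : HasCompactSupport (η.normed volume) := η.hasCompactSupport_normed
  rw [(hηc.hasFDerivAt_convolution_left (ContinuousLinearMap.lsmul ℝ ℝ) hη1 hU x).fderiv,
    ← convolution_flip]
  have hex : ConvolutionExistsAt U (fderiv ℝ (η.normed volume)) x
      ((ContinuousLinearMap.lsmul ℝ ℝ).precompL (EuclideanSpace ℝ (Fin N))).flip volume :=
    (hηc.fderiv ℝ).convolutionExists_right _ hU (hη1.continuous_fderiv one_ne_zero) x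
  rw [convolution_def, ContinuousLinearMap.integral_apply hex]
  rfl

/-- The ball condition makes `t ↦ η (x - t)` a test function on `Ω`, so the jump of the zero
extension across the boundary is not seen. The sign from reflecting `η` cancels the one from
integration by parts. -/
theorem hasGradientAt_convolution_normed (hΩ : IsOpen Ω) {u : EuclideanSpace ℝ (Fin N) → ℝ}
    {G : EuclideanSpace ℝ (Fin N) → EuclideanSpace ℝ (Fin N)} (h : HasWeakGradient Ω u G)
    (hu : IntegrableOn u Ω) (η : ContDiffBump (0 : EuclideanSpace ℝ (Fin N)))
    {x : EuclideanSpace ℝ (Fin N)} (hx : Metric.closedBall x η.rOut ⊆ Ω) :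
    HasGradientAt
      (convolution (η.normed volume) (Ω.indicator u) (ContinuousLinearMap.lsmul ℝ ℝ) volume)
      (∫ t in Ω, η.normed volume (x - t) • G t) x := by
  have hU : LocallyIntegrable (Ω.indicator u) :=
    (hu.integrable_indicator hΩ.measurableSet).locallyIntegrable
  have hηs : ContDiff ℝ ∞ (η.normed volume) := η.contDiff_normed
  have hηc : HasCompactSupport (η.normed volume) := η.hasCompactSupport_normed
  have hsupp : tsupport (fun t => η.normed volume (x - t)) ⊆ Metric.closedBall x η.rOut := by
    refine closure_minimal (fun t ht => ?_) Metric.isClosed_closedBall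
    have h1 : x - t ∈ tsupport (η.normed volume) := subset_tsupport _ ht
    rw [η.tsupport_normed_eq, mem_closedBall_zero_iff] at h1
    rwa [mem_closedBall_iff_norm']
  have hφ : IsTestFunction Ω (fun t => η.normed volume (x - t)) :=
    ⟨by fun_prop, HasCompactSupport.of_support_subset_isCompact (isCompact_closedBall x η.rOut)
      ((subset_tsupport _).trans hsupp), hsupp.trans hx⟩
  have hd : DifferentiableAt ℝ (convolution (η.normed volume) (Ω.indicator u)
      (ContinuousLinearMap.lsmul ℝ ℝ) volume) x :=
    (hηc.hasFDerivAt_convolution_left (ContinuousLinearMap.lsmul ℝ ℝ)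
      (hηs.of_le (mod_cast le_top)) hU x).differentiableAt
  rw [hasGradientAt_iff_hasFDerivAt]
  refine hd.hasFDerivAt.congr_fderiv (ContinuousLinearMap.ext fun v => ?_)
  rw [InnerProductSpace.toDual_apply_apply, real_inner_comm, setIntegral_testFunction_mul_inner h hφ,
    fderiv_convolution_normed_apply hU, ← integral_neg, ← integral_indicator hΩ.measurableSet]
  refine integral_congr_ae (.of_forall fun t => ?_)
  have hder : fderiv ℝ (fun t => η.normed volume (x - t)) t v
      = - fderiv ℝ (η.normed volume) (x - t) v := by
    have h1 : HasFDerivAt (fun t => x - t)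
        (-ContinuousLinearMap.id ℝ (EuclideanSpace ℝ (Fin N))) t := (hasFDerivAt_id t).const_sub x
    have h2 := ((hηs.differentiable (by simp)) (x - t)).hasFDerivAt.comp t h1
    rw [show (fun t => η.normed volume (x - t)) = η.normed volume ∘ fun t => x - t from rfl,
      h2.fderiv]
    simp
  by_cases ht : t ∈ Ω
  · simp only [Set.indicator_of_mem ht, hder]; ring
  · simp [Set.indicator_of_notMem ht]

/-- Young's inequality: Tonelli, and the kernel has total mass one. -/
theorem lintegral_fderiv_convolution_normed_le (hΩ : IsOpen Ω)
    {u : EuclideanSpace ℝ (Fin N) → ℝ}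
    {G : EuclideanSpace ℝ (Fin N) → EuclideanSpace ℝ (Fin N)} (h : HasWeakGradient Ω u G)
    (hu : IntegrableOn u Ω) (η : ContDiffBump (0 : EuclideanSpace ℝ (Fin N)))
    {K : Set (EuclideanSpace ℝ (Fin N))} (hKm : MeasurableSet K)
    (hK : ∀ x ∈ K, Metric.closedBall x η.rOut ⊆ Ω) :
    ∫⁻ x in K, ‖fderiv ℝ (convolution (η.normed volume) (Ω.indicator u)
      (ContinuousLinearMap.lsmul ℝ ℝ) volume) x‖ₑ ≤ ∫⁻ x in Ω, ‖G x‖ₑ := by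
  have hηm : Continuous (η.normed volume) := η.continuous_normed
  have hGm : AEStronglyMeasurable G (volume.restrict Ω) :=
    h.2.1.aestronglyMeasurable
  have hη1 : ∫⁻ x, ‖η.normed volume x‖ₑ = 1 := by
    have h1 := η.integral_normed (μ := volume)
    have h2 : Integrable (η.normed volume) := η.integrable_normed
    rw [← ofReal_integral_norm_eq_lintegral_enorm h2]
    simp_rw [Real.norm_of_nonneg (η.nonneg_normed _)]
    rw [h1, ENNReal.ofReal_one]
  calc _ ≤ ∫⁻ x in K, ∫⁻ t in Ω, ‖η.normed volume (x - t)‖ₑ * ‖G t‖ₑ := by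
        refine setLIntegral_mono' hKm fun x hx => ?_
        rw [(hasGradientAt_iff_hasFDerivAt.1
          (hasGradientAt_convolution_normed hΩ h hu η (hK x hx))).fderiv]
        rw [LinearIsometryEquiv.enorm_map]
        refine (enorm_integral_le_lintegral_enorm _).trans_eq ?_
        simp_rw [enorm_smul]
    _ ≤ ∫⁻ x, ∫⁻ t in Ω, ‖η.normed volume (x - t)‖ₑ * ‖G t‖ₑ := setLIntegral_le_lintegral _ _
    _ = ∫⁻ t in Ω, ∫⁻ x, ‖η.normed volume (x - t)‖ₑ * ‖G t‖ₑ := by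
        refine lintegral_lintegral_swap ?_
        refine AEMeasurable.mul (f := fun z : EuclideanSpace ℝ (Fin N) × EuclideanSpace ℝ (Fin N) =>
          ‖η.normed volume (z.1 - z.2)‖ₑ) (g := fun z => ‖G z.2‖ₑ) ?_ ?_
        · exact (hηm.comp (continuous_fst.sub continuous_snd)).enorm.aemeasurable
        · exact hGm.enorm.comp_quasiMeasurePreserving Measure.quasiMeasurePreserving_snd
    _ = ∫⁻ t in Ω, ‖G t‖ₑ := by
        refine lintegral_congr fun t => ?_
        have hm : Continuous fun x => η.normed volume (x - t) := hηm.comp (continuous_sub_right t)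
        rw [lintegral_mul_const _ hm.enorm.measurable,
          lintegral_sub_right_eq_self (fun x => ‖η.normed volume x‖ₑ) t, hη1, one_mul]

end WeakGradient

/-! ### The L¹ Poincaré inequality on the cube -/

section Poincare

variable {N : ℕ}

theorem lintegral_lintegral_enorm_sub_le {u : EuclideanSpace ℝ (Fin N) → ℝ}
    {G : EuclideanSpace ℝ (Fin N) → EuclideanSpace ℝ (Fin N)}
    (h : HasWeakGradient (unitCube N) u G) (hu : IntegrableOn u (unitCube N)) :
    ∫⁻ x in unitCube N, ∫⁻ y in unitCube N, ‖u x - u y‖ₑ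
      ≤ 2 ^ N * Metric.ediam (unitCube N) * ∫⁻ x in unitCube N, ‖G x‖ₑ := by
  set δ : ℕ → ℝ := fun n => 1 / (n + 1) with hδ
  have hδ0 : ∀ n, 0 < δ n := fun n => by positivity
  have hδt : Tendsto δ atTop (𝓝 0) := tendsto_one_div_add_atTop_nhds_zero_nat
  -- A fixed ratio `2` of outer to inner radius is what almost everywhere convergence of the
  -- mollifications requires.
  let η : ℕ → ContDiffBump (0 : EuclideanSpace ℝ (Fin N)) := fun n =>
    ⟨δ n / 2, δ n, half_pos (hδ0 n), half_lt_self (hδ0 n)⟩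
  set μ := (volume : Measure (EuclideanSpace ℝ (Fin N))).restrict (unitCube N) with hμ
  set w : ℕ → EuclideanSpace ℝ (Fin N) → ℝ := fun n =>
    convolution ((η n).normed volume) ((unitCube N).indicator u) (ContinuousLinearMap.lsmul ℝ ℝ)
      volume with hw
  have hU : LocallyIntegrable ((unitCube N).indicator u) :=
    (hu.integrable_indicator (isOpen_unitCube N).measurableSet).locallyIntegrable
  have hws : ∀ n, ContDiff ℝ 1 (w n) := fun n =>
    (η n).hasCompactSupport_normed.contDiff_convolution_left (n := 1) _
      (η n).contDiff_normed hU
  have hlim : ∀ᵐ x ∂μ, x ∈ unitCube N ∧ Tendsto (fun n => w n x) atTop (𝓝 (u x)) := by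
    have h1 := ContDiffBump.ae_convolution_tendsto_right_of_locallyIntegrable (φ := η) (K := 2)
      (l := atTop) hδt (.of_forall fun n => le_of_eq (by simp only [η]; ring)) hU
    filter_upwards [ae_restrict_of_ae h1, ae_restrict_mem (isOpen_unitCube N).measurableSet]
      with x hx hxQ
    rw [Set.indicator_of_mem hxQ] at hx
    exact ⟨hxQ, hx⟩
  have hKm : ∀ n, MeasurableSet (innerCube N (δ n)) := fun n => (isOpen_innerCube N _).measurableSet
  -- Cut off to the subcube, where the gradient of the mollification is controlled. Every point of
  -- the open cube eventually lies in it, so the cutoff vanishes in the limit and Fatou applies.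
  set F : ℕ → EuclideanSpace ℝ (Fin N) × EuclideanSpace ℝ (Fin N) → ℝ≥0∞ := fun n =>
    (innerCube N (δ n) ×ˢ innerCube N (δ n)).indicator fun z => ‖w n z.1 - w n z.2‖ₑ with hF
  have hFm : ∀ n, Measurable (F n) := fun n => by
    have := (hws n).continuous
    exact Measurable.indicator (by fun_prop) ((hKm n).prod (hKm n))
  have hFle : ∀ n, ∫⁻ z, F n z ∂μ.prod μ
      ≤ 2 ^ N * Metric.ediam (unitCube N) * ∫⁻ x in unitCube N, ‖G x‖ₑ := fun n => by
    have hsub := innerCube_subset_unitCube (N := N) (hδ0 n).le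
    have hc := (hws n).continuous
    have hrr : μ.restrict (innerCube N (δ n)) = volume.restrict (innerCube N (δ n)) := by
      rw [hμ, Measure.restrict_restrict (hKm n), Set.inter_eq_left.2 hsub]
    calc ∫⁻ z, F n z ∂μ.prod μ
        = ∫⁻ x in innerCube N (δ n), ∫⁻ y in innerCube N (δ n), ‖w n x - w n y‖ₑ := by
          rw [hF, lintegral_indicator ((hKm n).prod (hKm n)), ← Measure.prod_restrict, hrr,
            lintegral_prod _ (by fun_prop)]
      _ ≤ 2 ^ N * volume (innerCube N (δ n)) * Metric.ediam (innerCube N (δ n))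
            * ∫⁻ x in innerCube N (δ n), ‖fderiv ℝ (w n) x‖ₑ := by
          simpa using lintegral_lintegral_enorm_sub_le_of_contDiff volume (hws n)
            (convex_innerCube N (δ n)) (hKm n)
      _ ≤ 2 ^ N * 1 * Metric.ediam (unitCube N) * ∫⁻ x in unitCube N, ‖G x‖ₑ := by
          refine mul_le_mul' (mul_le_mul' (mul_le_mul' le_rfl ?_) (Metric.ediam_mono hsub)) ?_
          · exact (measure_mono hsub).trans (volume_unitCube N).le
          · exact lintegral_fderiv_convolution_normed_le (isOpen_unitCube N) h hu (η n) (hKm n)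
              fun x hx => closedBall_subset_unitCube hx
      _ = _ := by rw [mul_one]
  have hum : AEMeasurable u μ := hu.aemeasurable
  have hprod : AEMeasurable (fun z : EuclideanSpace ℝ (Fin N) × EuclideanSpace ℝ (Fin N) =>
      ‖u z.1 - u z.2‖ₑ) (μ.prod μ) :=
    ((hum.comp_quasiMeasurePreserving Measure.quasiMeasurePreserving_fst).sub
      (hum.comp_quasiMeasurePreserving Measure.quasiMeasurePreserving_snd)).enorm
  calc ∫⁻ x, ∫⁻ y, ‖u x - u y‖ₑ ∂μ ∂μ
      = ∫⁻ z, ‖u z.1 - u z.2‖ₑ ∂μ.prod μ := (lintegral_prod _ hprod).symm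
    _ ≤ ∫⁻ z, liminf (fun n => F n z) atTop ∂μ.prod μ := by
        refine lintegral_mono_ae ?_
        filter_upwards [Measure.quasiMeasurePreserving_fst.ae hlim,
          Measure.quasiMeasurePreserving_snd.ae hlim] with z h1 h2
        refine (Tendsto.liminf_eq ?_).ge
        refine ((h1.2.sub h2.2).enorm).congr' ?_
        filter_upwards [eventually_mem_innerCube h1.1 hδt, eventually_mem_innerCube h2.1 hδt]
          with n hn1 hn2
        exact (Set.indicator_of_mem (s := innerCube N (δ n) ×ˢ innerCube N (δ n))
          (Set.mk_mem_prod hn1 hn2) fun z => ‖w n z.1 - w n z.2‖ₑ).symm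
    _ ≤ liminf (fun n => ∫⁻ z, F n z ∂μ.prod μ) atTop := lintegral_liminf_le hFm
    _ ≤ _ := liminf_le_of_le (by isBoundedDefault) fun b hb =>
        let ⟨n, hn⟩ := hb.exists; hn.trans (hFle n)

theorem lintegral_enorm_sub_cubeAverage_le {u : EuclideanSpace ℝ (Fin N) → ℝ}
    (hu : IntegrableOn u (unitCube N)) :
    ∫⁻ x in unitCube N, ‖u x - cubeAverage u‖ₑ
      ≤ ∫⁻ x in unitCube N, ∫⁻ y in unitCube N, ‖u x - u y‖ₑ := by
  refine lintegral_mono fun x => ?_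
  have : u x - cubeAverage u = ∫ y in unitCube N, (u x - u y) := by
    rw [integral_sub (integrable_const _) hu]
    simp [cubeAverage]
  rw [this]
  exact enorm_integral_le_lintegral_enorm _

/-- Without this, `poincareConstant N` could be the junk value `sInf ∅ = 0`. -/
theorem exists_isPoincareConstant (N : ℕ) : ∃ c, IsPoincareConstant N c := by
  have hfin : (2 ^ N * Metric.ediam (unitCube N)) ≠ ⊤ :=
    ENNReal.mul_ne_top (by finiteness) (isBounded_unitCube N).ediam_ne_top
  refine ⟨(2 ^ N * Metric.ediam (unitCube N)).toReal, ENNReal.toReal_nonneg, ?_⟩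
  rintro u G ⟨hu, G', hG', hG'm⟩ hG
  have hae := hG.ae_eq (isOpen_unitCube N) hG'
  have hGm : MemLp G 1 (volume.restrict (unitCube N)) := hG'm.ae_eq hae.symm
  have hui : IntegrableOn u (unitCube N) := memLp_one_iff_integrable.1 hu
  have hum : AEStronglyMeasurable (fun x => u x - cubeAverage u) (volume.restrict (unitCube N)) :=
    hu.aestronglyMeasurable.sub aestronglyMeasurable_const
  rw [← toReal_eLpNorm hum, ← toReal_eLpNorm hGm.aestronglyMeasurable, ← ENNReal.toReal_mul]
  refine ENNReal.toReal_mono (ENNReal.mul_ne_top hfin hGm.eLpNorm_ne_top) ?_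
  rw [eLpNorm_one_eq_lintegral_enorm, eLpNorm_one_eq_lintegral_enorm]
  exact (lintegral_enorm_sub_cubeAverage_le hui).trans (lintegral_lintegral_enorm_sub_le hG hui)

/-- Admissibility is an intersection of closed conditions on `c`, so the infimum is attained. -/
theorem isPoincareConstant_poincareConstant (N : ℕ) :
    IsPoincareConstant N (poincareConstant N) := by
  have hne : {c : ℝ | IsPoincareConstant N c}.Nonempty := exists_isPoincareConstant N
  have hbdd : BddBelow {c : ℝ | IsPoincareConstant N c} := ⟨0, fun c hc => hc.1⟩
  have hcl : IsClosed {c : ℝ | IsPoincareConstant N c} := by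
    simp only [IsPoincareConstant, Set.ofPred_and, Set.ofPred_forall]
    refine (isClosed_le continuous_const continuous_id).inter ?_
    exact isClosed_iInter fun u => isClosed_iInter fun G => isClosed_iInter fun _ =>
      isClosed_iInter fun _ => isClosed_le continuous_const (by fun_prop)
  exact hcl.csInf_mem hne hbdd

end Poincare


/-! ### Tiling by integer translates, and periodicity -/

section Lattice

variable {N : ℕ}

/-- The integer lattice `ℤ^N` in `ℝ^N`. -/
abbrev intLattice (N : ℕ) : Submodule ℤ (EuclideanSpace ℝ (Fin N)) :=
  Submodule.span ℤ (Set.range (EuclideanSpace.basisFun (Fin N) ℝ).toBasis)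

theorem unitCube_ae_eq_fundamentalDomain (N : ℕ) :
    unitCube N =ᵐ[volume]
      ZSpan.fundamentalDomain (EuclideanSpace.basisFun (Fin N) ℝ).toBasis := by
  have h1 : ZSpan.fundamentalDomain (EuclideanSpace.basisFun (Fin N) ℝ).toBasis
      = WithLp.ofLp ⁻¹' (Set.univ.pi fun _ : Fin N => Set.Ico (0 : ℝ) 1) := by
    ext x; simp [ZSpan.mem_fundamentalDomain]
  have h2 : (Set.univ.pi fun _ : Fin N => Set.Ioo (0 : ℝ) 1)
      =ᵐ[volume] Set.univ.pi fun _ : Fin N => Set.Ico (0 : ℝ) 1 :=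
    Measure.univ_pi_Ioo_ae_eq_Icc.trans Measure.univ_pi_Ico_ae_eq_Icc.symm
  rw [h1, unitCube_eq_preimage]
  exact (PiLp.volume_preserving_ofLp (Fin N)).quasiMeasurePreserving.preimage_ae_eq h2

/-- The open cube agrees up to a null set with the half-open fundamental domain of the lattice. -/
theorem hasSum_setIntegral_unitCube {F : Type*} [NormedAddCommGroup F] [NormedSpace ℝ F]
    {f : EuclideanSpace ℝ (Fin N) → F} (hf : Integrable f) :
    HasSum (fun z : intLattice N => ∫ x in unitCube N, f (z + x)) (∫ x, f x) := by
  have hD := ZSpan.isAddFundamentalDomain (EuclideanSpace.basisFun (Fin N) ℝ).toBasis volume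
  have : VAddInvariantMeasure (intLattice N) (EuclideanSpace ℝ (Fin N)) volume :=
    ⟨fun z s _ => measure_preimage_add volume (z : EuclideanSpace ℝ (Fin N)) s⟩
  have hs := hD.sum_restrict
  have h1 := hasSum_integral_measure (f := f) (by rwa [hs])
  rw [hs] at h1
  refine h1.congr_fun fun z => ?_
  rw [setIntegral_congr_set (unitCube_ae_eq_fundamentalDomain N)]
  exact ((measurePreserving_add_left volume (z : EuclideanSpace ℝ (Fin N))).setIntegral_image_emb
    (measurableEmbedding_addLeft (z : EuclideanSpace ℝ (Fin N))) f _).symm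

theorem IsCubePeriodic.ae_eq_add {g : EuclideanSpace ℝ (Fin N) → ℝ} (hg : IsCubePeriodic g)
    {z : EuclideanSpace ℝ (Fin N)} (hz : z ∈ intLattice N) : ∀ᵐ x, g (z + x) = g x := by
  have hq : ∀ y : EuclideanSpace ℝ (Fin N),
      Measure.QuasiMeasurePreserving (fun x => y + x) volume volume := fun y =>
    (measurePreserving_add_left volume y).quasiMeasurePreserving
  have mem : ∀ y ∈ AddSubgroup.closure
      (Set.range (EuclideanSpace.basisFun (Fin N) ℝ).toBasis), y ∈ intLattice N := fun y hy => by
    rwa [← Submodule.span_int_eq_addSubgroupClosure] at hy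
  have hz' : z ∈ AddSubgroup.closure
      (Set.range (EuclideanSpace.basisFun (Fin N) ℝ).toBasis) := by
    rwa [← Submodule.span_int_eq_addSubgroupClosure]
  induction hz' using AddSubgroup.closure_induction with
  | mem y hy =>
    obtain ⟨i, rfl⟩ := hy
    filter_upwards [hg i] with x hx
    simpa [add_comm] using hx
  | zero => simp
  | add y w hy hw h1 h2 =>
    filter_upwards [(hq w).ae (h1 (mem y hy)), h2 (mem w hw)] with x hx1 hx2
    rw [add_assoc, hx1, hx2]
  | neg y hy h1 =>
    filter_upwards [(hq (-y)).ae (h1 (mem y hy))] with x hx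
    rw [← hx, add_neg_cancel_left]

end Lattice

/-! ### Smooth functions as Sobolev functions on the cube -/

section Smooth

variable {N : ℕ}

theorem continuous_gradient {w : EuclideanSpace ℝ (Fin N) → ℝ} (hw : ContDiff ℝ 1 w) :
    Continuous (gradient w) :=
  (LinearIsometryEquiv.continuous _).comp (hw.continuous_fderiv one_ne_zero)

theorem norm_gradient (w : EuclideanSpace ℝ (Fin N) → ℝ) (x : EuclideanSpace ℝ (Fin N)) :
    ‖gradient w x‖ = ‖fderiv ℝ w x‖ := LinearIsometryEquiv.norm_map _ _

theorem hasCompactSupport_gradient {w : EuclideanSpace ℝ (Fin N) → ℝ}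
    (hw : HasCompactSupport w) : HasCompactSupport (gradient w) :=
  (hw.fderiv ℝ).comp_left (map_zero _)

theorem hasWeakGradient_gradient (Ω : Set (EuclideanSpace ℝ (Fin N)))
    {w : EuclideanSpace ℝ (Fin N) → ℝ} (hw : ContDiff ℝ 1 w) :
    HasWeakGradient Ω w (gradient w) := by
  refine ⟨hw.continuous.locallyIntegrable.locallyIntegrableOn _,
    (continuous_gradient hw).locallyIntegrable.locallyIntegrableOn _, fun φ hφ v => ?_⟩
  have hφ1 : ContDiff ℝ 1 φ := hφ.1.of_le (mod_cast le_top)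
  have hd : Continuous fun x => fderiv ℝ w x v :=
    (hw.continuous_fderiv one_ne_zero).clm_apply continuous_const
  have hdφ : Continuous fun x => fderiv ℝ φ x v :=
    (hφ1.continuous_fderiv one_ne_zero).clm_apply continuous_const
  have hsφ : HasCompactSupport fun x => fderiv ℝ φ x v := hφ.2.1.fderiv_apply ℝ v
  have h1 : ∫ x in Ω, w x * fderiv ℝ φ x v = ∫ x, w x * fderiv ℝ φ x v :=
    setIntegral_eq_integral_of_forall_compl_eq_zero fun x hx => by
      rw [fderiv_of_notMem_tsupport ℝ fun h => hx (hφ.2.2 h)]; simp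
  have h2 : ∫ x in Ω, φ x * inner ℝ (gradient w x) v = ∫ x, fderiv ℝ w x v * φ x := by
    rw [setIntegral_eq_integral_of_forall_compl_eq_zero fun x hx => by
      rw [hφ.eq_zero_of_notMem hx, zero_mul]]
    simp_rw [inner_gradient_left, mul_comm]
  rw [h1, h2]
  refine integral_mul_fderiv_eq_neg_fderiv_mul_of_integrable ?_ ?_ ?_
    (fun x _ => hw.differentiable one_ne_zero x) (fun x _ => hφ1.differentiable one_ne_zero x)
  · exact (hd.mul hφ.1.continuous).integrable_of_hasCompactSupport hφ.2.1.mul_left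
  · exact (hw.continuous.mul hdφ).integrable_of_hasCompactSupport hsφ.mul_left
  · exact (hw.continuous.mul hφ.1.continuous).integrable_of_hasCompactSupport hφ.2.1.mul_left

theorem _root_.Continuous.integrableOn_unitCube {F : Type*} [NormedAddCommGroup F]
    {f : EuclideanSpace ℝ (Fin N) → F} (hf : Continuous f) : IntegrableOn f (unitCube N) :=
  (hf.locallyIntegrable.integrableOn_isCompact (isBounded_unitCube N).isCompact_closure).mono_set
    subset_closure

theorem integral_abs_sub_cubeAverage_le {w : EuclideanSpace ℝ (Fin N) → ℝ}
    (hw : ContDiff ℝ 1 w) :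
    ∫ x in unitCube N, |w x - cubeAverage w|
      ≤ poincareConstant N * ∫ x in unitCube N, ‖gradient w x‖ := by
  have hG := continuous_gradient hw
  have hwg := hasWeakGradient_gradient (unitCube N) hw
  have h := (isPoincareConstant_poincareConstant N).2 w (gradient w)
    ⟨memLp_one_iff_integrable.2 hw.continuous.integrableOn_unitCube, _, hwg,
      memLp_one_iff_integrable.2 hG.integrableOn_unitCube⟩ hwg
  have hc : Continuous fun x => w x - cubeAverage w := by have := hw.continuous; fun_prop
  rwa [lpNorm_one_eq_integral_norm hc.aestronglyMeasurable,
    lpNorm_one_eq_integral_norm hG.aestronglyMeasurable] at h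

end Smooth

/-! ### Integrals against a periodic function of mean zero -/

section Oscillation

variable {N : ℕ} {a : EuclideanSpace ℝ (Fin N) → ℝ} {M : ℝ}

theorem abs_setIntegral_unitCube_mul_le (ha : AEMeasurable a) (haM : ∀ᵐ x, |a x| ≤ M)
    (ha0 : ∫ x in unitCube N, a x = 0) {w : EuclideanSpace ℝ (Fin N) → ℝ} (hw : ContDiff ℝ 1 w) :
    |∫ x in unitCube N, a x * w x|
      ≤ M * (poincareConstant N * ∫ x in unitCube N, ‖gradient w x‖) := by
  have hM : 0 ≤ M := let ⟨x, hx⟩ := haM.exists; (abs_nonneg _).trans hx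
  have hai : IntegrableOn a (unitCube N) :=
    Integrable.of_bound ha.restrict.aestronglyMeasurable M (ae_restrict_of_ae haM)
  have hwi := hw.continuous.integrableOn_unitCube
  have haw : IntegrableOn (fun x => a x * w x) (unitCube N) :=
    hwi.bdd_mul hai.aestronglyMeasurable (ae_restrict_of_ae haM)
  -- The only use of the mean-zero hypothesis: constants are invisible to `a`.
  have h1 : ∫ x in unitCube N, a x * w x = ∫ x in unitCube N, a x * (w x - cubeAverage w) := by
    simp_rw [mul_sub]
    rw [integral_sub haw (hai.mul_const _), integral_mul_const, ha0, zero_mul, sub_zero]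
  have hdi : IntegrableOn (fun x => |w x - cubeAverage w|) (unitCube N) :=
    (hwi.sub (integrable_const _)).abs
  rw [h1]
  calc |∫ x in unitCube N, a x * (w x - cubeAverage w)|
      ≤ ∫ x in unitCube N, M * |w x - cubeAverage w| := by
        rw [← Real.norm_eq_abs]
        refine norm_integral_le_of_norm_le (hdi.const_mul M) ?_
        filter_upwards [ae_restrict_of_ae haM] with x hx
        rw [Real.norm_eq_abs, abs_mul]
        gcongr
    _ = M * ∫ x in unitCube N, |w x - cubeAverage w| := integral_const_mul _ _
    _ ≤ _ := by gcongr; exact integral_abs_sub_cubeAverage_le hw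

theorem abs_integral_periodic_mul_le (ha : AEMeasurable a) (haM : ∀ᵐ x, |a x| ≤ M)
    (haper : IsCubePeriodic a) (ha0 : ∫ x in unitCube N, a x = 0)
    {w : EuclideanSpace ℝ (Fin N) → ℝ} (hw : ContDiff ℝ 1 w) (hwc : HasCompactSupport w) :
    |∫ x, a x * w x| ≤ M * (poincareConstant N * ∫ x, ‖gradient w x‖) := by
  have hwi : Integrable w := hw.continuous.integrable_of_hasCompactSupport hwc
  have hgi : Integrable fun x => ‖gradient w x‖ :=
    ((continuous_gradient hw).integrable_of_hasCompactSupport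
      (hasCompactSupport_gradient hwc)).norm
  have haw : Integrable fun x => a x * w x := hwi.bdd_mul ha.aestronglyMeasurable haM
  have hsum := ((hasSum_setIntegral_unitCube hgi).mul_left (poincareConstant N)).mul_left M
  refine (hasSum_setIntegral_unitCube haw).norm_le_of_bounded hsum fun z => ?_
  have hwz : ContDiff ℝ 1 fun x => w (z + x) := hw.comp (contDiff_const.add contDiff_id)
  have hgz : ∀ x, gradient (fun x => w (z + x)) x = gradient w (z + x) := fun x => by
    simp only [gradient, fderiv_comp_add_left]
  have h1 : ∫ x in unitCube N, a (z + x) * w (z + x) = ∫ x in unitCube N, a x * w (z + x) := by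
    refine integral_congr_ae ?_
    filter_upwards [ae_restrict_of_ae (haper.ae_eq_add z.2)] with x hx
    rw [hx]
  rw [h1]
  simpa only [hgz, Real.norm_eq_abs] using abs_setIntegral_unitCube_mul_le ha haM ha0 hwz

/-- The Jacobians `ε ^ N` cancel; the chain rule leaves a single `ε`. -/
theorem abs_integral_rescaled_periodic_mul_le (ha : AEMeasurable a) (haM : ∀ᵐ x, |a x| ≤ M)
    (haper : IsCubePeriodic a) (ha0 : ∫ x in unitCube N, a x = 0) {ε : ℝ} (hε : 0 < ε)
    {w : EuclideanSpace ℝ (Fin N) → ℝ} (hw : ContDiff ℝ 1 w) (hwc : HasCompactSupport w) :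
    |∫ x, a (ε⁻¹ • x) * w x| ≤ M * (poincareConstant N * (ε * ∫ x, ‖gradient w x‖)) := by
  have hwε : ContDiff ℝ 1 fun x => w (ε • x) := hw.comp (contDiff_id.const_smul ε)
  have hwεc : HasCompactSupport fun x => w (ε • x) := hwc.comp_smul hε.ne'
  have hgε : ∀ x, ‖gradient (fun x => w (ε • x)) x‖ = ε * ‖gradient w (ε • x)‖ := fun x => by
    rw [norm_gradient, norm_gradient, fderiv_comp_smul, norm_smul, Real.norm_of_nonneg hε.le]
  have h1 : ∫ x, a (ε⁻¹ • x) * w x = ε ^ N * ∫ x, a x * w (ε • x) := by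
    have h := Measure.integral_comp_inv_smul_of_nonneg volume
      (fun x : EuclideanSpace ℝ (Fin N) => a x * w (ε • x)) hε.le
    simpa [smul_smul, hε.ne'] using h
  have h2 : ∫ x, ‖gradient (fun x => w (ε • x)) x‖ = (ε ^ N)⁻¹ * (ε * ∫ x, ‖gradient w x‖) := by
    simp_rw [hgε]
    rw [integral_const_mul, Measure.integral_comp_smul_of_nonneg volume
      (fun x : EuclideanSpace ℝ (Fin N) => ‖gradient w x‖) ε (hR := hε.le)]
    simp; ring
  have h3 := abs_integral_periodic_mul_le ha haM haper ha0 hwε hwεc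
  rw [h2] at h3
  have hεN : 0 < ε ^ N := by positivity
  rw [h1, abs_mul, abs_of_pos hεN]
  calc ε ^ N * |∫ x, a x * w (ε • x)|
      ≤ ε ^ N * (M * (poincareConstant N * ((ε ^ N)⁻¹ * (ε * ∫ x, ‖gradient w x‖)))) := by gcongr
    _ = _ := by field_simp

end Oscillation


/-! ### Passing to the limit in `L^p`, and Hölder's inequality -/

section LpConvergence

variable {α F : Type*} {m : MeasurableSpace α} {μ : Measure α} [NormedAddCommGroup F]

theorem lpNorm_congr_ae {f f' : α → F} (h : f =ᵐ[μ] f') (q : ℝ≥0∞) :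
    lpNorm f q μ = lpNorm f' q μ := by
  by_cases hf : AEStronglyMeasurable f μ
  · rw [← toReal_eLpNorm hf, ← toReal_eLpNorm (hf.congr h), eLpNorm_congr_ae h]
  · rw [lpNorm_of_not_aestronglyMeasurable hf,
      lpNorm_of_not_aestronglyMeasurable fun h' => hf (h'.congr h.symm)]

theorem tendsto_lpNorm_of_tendsto_eLpNorm_sub {q : ℝ≥0∞} (hq : 1 ≤ q) {f : ℕ → α → F} {f' : α → F}
    (hf : ∀ n, MemLp (f n) q μ) (hf' : MemLp f' q μ)
    (h : Tendsto (fun n => eLpNorm (fun x => f n x - f' x) q μ) atTop (𝓝 0)) :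
    Tendsto (fun n => lpNorm (f n) q μ) atTop (𝓝 (lpNorm f' q μ)) := by
  have h0 : Tendsto (fun n => lpNorm (f n - f') q μ) atTop (𝓝 0) := by
    have h1 := (ENNReal.tendsto_toReal ENNReal.zero_ne_top).comp h
    rw [ENNReal.toReal_zero] at h1
    refine h1.congr fun n => ?_
    exact toReal_eLpNorm ((hf n).sub hf').aestronglyMeasurable
  refine tendsto_iff_dist_tendsto_zero.2 (squeeze_zero (fun _ => dist_nonneg) (fun n => ?_) h0)
  rw [Real.dist_eq, abs_le]
  have h1 := lpNorm_le_lpNorm_add_lpNorm_sub' (f := f n) hf' hq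
  have h2 := lpNorm_le_lpNorm_add_lpNorm_sub (f := f') (hf n) hq
  constructor <;> linarith

variable {p : ℝ}

theorem integral_norm_rpow_eq_lpNorm_rpow (hp : 0 < p) {f : α → F} (hf : AEStronglyMeasurable f μ) :
    ∫ x, ‖f x‖ ^ p ∂μ = lpNorm f (ENNReal.ofReal p) μ ^ p := by
  have h0 : 0 ≤ ∫ x, ‖f x‖ ^ p ∂μ := integral_nonneg fun x => by positivity
  rw [lpNorm_eq_integral_norm_rpow_toReal (by simpa using hp) ENNReal.ofReal_ne_top hf,
    ENNReal.toReal_ofReal hp.le, Real.rpow_inv_rpow h0 hp.ne']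

theorem integrable_abs_rpow (hp : 0 < p) {f : α → ℝ} (hf : MemLp f (ENNReal.ofReal p) μ) :
    Integrable (fun x => |f x| ^ p) μ := by
  simpa [ENNReal.toReal_ofReal hp.le] using
    hf.integrable_norm_rpow (by simpa using hp) ENNReal.ofReal_ne_top

theorem tendsto_integral_abs_rpow (hp : 1 < p) {f : ℕ → α → ℝ} {f' : α → ℝ}
    (hf : ∀ n, MemLp (f n) (ENNReal.ofReal p) μ) (hf' : MemLp f' (ENNReal.ofReal p) μ)
    (h : Tendsto (fun n => eLpNorm (fun x => f n x - f' x) (ENNReal.ofReal p) μ) atTop (𝓝 0)) :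
    Tendsto (fun n => ∫ x, |f n x| ^ p ∂μ) atTop (𝓝 (∫ x, |f' x| ^ p ∂μ)) := by
  have hp0 : 0 < p := by linarith
  simp only [← Real.norm_eq_abs, integral_norm_rpow_eq_lpNorm_rpow hp0 (hf _).aestronglyMeasurable,
    integral_norm_rpow_eq_lpNorm_rpow hp0 hf'.aestronglyMeasurable]
  exact (tendsto_lpNorm_of_tendsto_eLpNorm_sub (by simpa using hp.le) hf hf' h).rpow_const
    (.inr hp0.le)

/-- A nonnegative weight is absorbed as `b |f|^p = |b^(1/p) f|^p`, reducing the claim to convergence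
of norms. -/
theorem tendsto_integral_mul_abs_rpow_of_nonneg (hp : 1 < p) {b : α → ℝ} {C : ℝ}
    (hb : AEMeasurable b μ) (hb0 : ∀ᵐ x ∂μ, 0 ≤ b x) (hbC : ∀ᵐ x ∂μ, b x ≤ C)
    {f : ℕ → α → ℝ} {f' : α → ℝ}
    (hf : ∀ n, MemLp (f n) (ENNReal.ofReal p) μ) (hf' : MemLp f' (ENNReal.ofReal p) μ)
    (h : Tendsto (fun n => eLpNorm (fun x => f n x - f' x) (ENNReal.ofReal p) μ) atTop (𝓝 0)) :
    Tendsto (fun n => ∫ x, b x * |f n x| ^ p ∂μ) atTop (𝓝 (∫ x, b x * |f' x| ^ p ∂μ)) := by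
  have hp0 : 0 < p := by linarith
  set c : α → ℝ := fun x => b x ^ p⁻¹ with hc
  have hcm : AEMeasurable c μ := hb.pow_const _
  have hcC : ∀ᵐ x ∂μ, ‖c x‖ ≤ C ^ p⁻¹ := by
    filter_upwards [hb0, hbC] with x h0 h1
    rw [hc, Real.norm_of_nonneg (by positivity)]
    exact Real.rpow_le_rpow h0 h1 (by positivity)
  have hle : ∀ k : α → ℝ, ∀ᵐ x ∂μ, ‖c x * k x‖ ≤ C ^ p⁻¹ * ‖k x‖ := fun k => by
    filter_upwards [hcC] with x hx
    rw [norm_mul]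
    gcongr
  have hmem : ∀ k : α → ℝ, MemLp k (ENNReal.ofReal p) μ →
      MemLp (fun x => c x * k x) (ENNReal.ofReal p) μ := fun k hk =>
    hk.of_le_mul (hcm.aestronglyMeasurable.mul hk.aestronglyMeasurable) (hle k)
  have heq : ∀ k : α → ℝ, ∫ x, b x * |k x| ^ p ∂μ = ∫ x, |c x * k x| ^ p ∂μ := fun k => by
    refine integral_congr_ae ?_
    filter_upwards [hb0] with x hx
    rw [abs_mul, Real.mul_rpow (abs_nonneg _) (abs_nonneg _), hc,
      abs_of_nonneg (Real.rpow_nonneg hx _), Real.rpow_inv_rpow hx hp0.ne']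
  simp_rw [heq]
  refine tendsto_integral_abs_rpow hp (fun n => hmem _ (hf n)) (hmem _ hf') ?_
  have hlim : Tendsto (fun n => ENNReal.ofReal (C ^ p⁻¹) *
      eLpNorm (fun x => f n x - f' x) (ENNReal.ofReal p) μ) atTop (𝓝 0) := by
    simpa using ENNReal.Tendsto.const_mul h (.inr ENNReal.ofReal_ne_top)
  refine tendsto_of_tendsto_of_tendsto_of_le_of_le tendsto_const_nhds hlim
    (fun _ => zero_le) fun n => ?_
  simp_rw [← mul_sub]
  exact eLpNorm_le_mul_eLpNorm_of_ae_le_mul (hle _) _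

theorem tendsto_integral_mul_abs_rpow (hp : 1 < p) {b : α → ℝ} {C : ℝ}
    (hb : AEMeasurable b μ) (hbC : ∀ᵐ x ∂μ, |b x| ≤ C) {f : ℕ → α → ℝ} {f' : α → ℝ}
    (hf : ∀ n, MemLp (f n) (ENNReal.ofReal p) μ) (hf' : MemLp f' (ENNReal.ofReal p) μ)
    (h : Tendsto (fun n => eLpNorm (fun x => f n x - f' x) (ENNReal.ofReal p) μ) atTop (𝓝 0)) :
    Tendsto (fun n => ∫ x, b x * |f n x| ^ p ∂μ) atTop (𝓝 (∫ x, b x * |f' x| ^ p ∂μ)) := by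
  have hp0 : 0 < p := by linarith
  -- A signed weight is shifted by `C` to be nonnegative, and the constant part is subtracted again.
  have h1 := tendsto_integral_mul_abs_rpow_of_nonneg hp (b := fun x => b x + C) (C := C + C)
    (hb.add_const C) (hbC.mono fun x hx => by linarith [(abs_le.1 hx).1])
    (hbC.mono fun x hx => by linarith [(abs_le.1 hx).2]) hf hf' h
  have h2 := (tendsto_integral_abs_rpow hp hf hf' h).const_mul C
  have heq : ∀ k : α → ℝ, MemLp k (ENNReal.ofReal p) μ →
      ∫ x, b x * |k x| ^ p ∂μ = ∫ x, (b x + C) * |k x| ^ p ∂μ - C * ∫ x, |k x| ^ p ∂μ :=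
    fun k hk => by
      have hk' := integrable_abs_rpow hp0 hk
      simp_rw [add_mul]
      rw [integral_add (hk'.bdd_mul hb.aestronglyMeasurable hbC) (hk'.const_mul C),
        integral_const_mul, add_sub_cancel_right]
  rw [heq f' hf']
  exact (h1.sub h2).congr fun n => (heq _ (hf n)).symm

theorem integral_abs_rpow_mul_norm_le (hp : 1 < p) {f : α → ℝ} {G : α → F}
    (hf : MemLp f (ENNReal.ofReal p) μ) (hG : MemLp G (ENNReal.ofReal p) μ) :
    ∫ x, |f x| ^ (p - 1) * ‖G x‖ ∂μ
      ≤ lpNorm f (ENNReal.ofReal p) μ ^ (p - 1) * lpNorm G (ENNReal.ofReal p) μ := by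
  have hp0 : 0 < p := by linarith
  have hp1 : 0 < p - 1 := by linarith
  have hpq : p.HolderConjugate (p / (p - 1)) := .conjExponent hp
  have hfm : MemLp (fun x => |f x| ^ (p - 1)) (ENNReal.ofReal (p / (p - 1))) μ := by
    have h := hf.norm_rpow_div (ENNReal.ofReal (p - 1))
    rwa [ENNReal.toReal_ofReal hp1.le, ← ENNReal.ofReal_div_of_pos hp1] at h
  have h := integral_mul_le_Lp_mul_Lq_of_nonneg hpq.symm (μ := μ)
    (f := fun x => |f x| ^ (p - 1)) (g := fun x => ‖G x‖)
    (.of_forall fun x => by positivity) (.of_forall fun x => by positivity) hfm hG.norm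
  refine h.trans_eq ?_
  have e : ∀ x, (|f x| ^ (p - 1)) ^ (p / (p - 1)) = ‖f x‖ ^ p := fun x => by
    rw [← Real.rpow_mul (abs_nonneg _), mul_div_cancel₀ _ hp1.ne', Real.norm_eq_abs]
  simp_rw [e]
  rw [integral_norm_rpow_eq_lpNorm_rpow hp0 hf.aestronglyMeasurable,
    integral_norm_rpow_eq_lpNorm_rpow hp0 hG.aestronglyMeasurable,
    ← Real.rpow_mul lpNorm_nonneg, ← Real.rpow_mul lpNorm_nonneg]
  congr 2
  · field_simp
  · rw [mul_one_div_cancel hp0.ne', Real.rpow_one]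

end LpConvergence

/-! ### The estimate for test functions -/

section Main

variable {N : ℕ} {Ω : Set (EuclideanSpace ℝ (Fin N))} {a : EuclideanSpace ℝ (Fin N) → ℝ} {M p : ℝ}

theorem IsTestFunction.memLp {φ : EuclideanSpace ℝ (Fin N) → ℝ} (hφ : IsTestFunction Ω φ)
    (q : ℝ≥0∞) (μ : Measure (EuclideanSpace ℝ (Fin N))) [IsFiniteMeasureOnCompacts μ] :
    MemLp φ q μ :=
  hφ.1.continuous.memLp_of_hasCompactSupport hφ.2.1

theorem IsTestFunction.memLp_gradient {φ : EuclideanSpace ℝ (Fin N) → ℝ}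
    (hφ : IsTestFunction Ω φ) (q : ℝ≥0∞) (μ : Measure (EuclideanSpace ℝ (Fin N)))
    [IsFiniteMeasureOnCompacts μ] : MemLp (gradient φ) q μ :=
  (continuous_gradient (hφ.1.of_le (mod_cast le_top))).memLp_of_hasCompactSupport
    (hasCompactSupport_gradient hφ.2.1)

theorem IsTestFunction.abs_setIntegral_rescaled_periodic_mul_rpow_le (hp : 1 < p)
    (ha : AEMeasurable a) (haM : ∀ᵐ x, |a x| ≤ M) (haper : IsCubePeriodic a)
    (ha0 : ∫ x in unitCube N, a x = 0) {ε : ℝ} (hε : 0 < ε)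
    {φ : EuclideanSpace ℝ (Fin N) → ℝ} (hφ : IsTestFunction Ω φ) :
    |∫ x in Ω, a (ε⁻¹ • x) * |φ x| ^ p| ≤
      p * poincareConstant N * M * ε
        * lpNorm φ (ENNReal.ofReal p) (volume.restrict Ω) ^ (p - 1)
        * lpNorm (gradient φ) (ENNReal.ofReal p) (volume.restrict Ω) := by
  have hp0 : 0 < p := by linarith
  have hM : 0 ≤ M := let ⟨x, hx⟩ := haM.exists; (abs_nonneg _).trans hx
  have hc1 : 0 ≤ poincareConstant N := (isPoincareConstant_poincareConstant N).1
  have hφ1 : ContDiff ℝ 1 φ := hφ.1.of_le (mod_cast le_top)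
  have hw : ContDiff ℝ 1 fun x => |φ x| ^ p := by
    simpa only [← Real.norm_eq_abs] using hφ1.norm_rpow hp
  have hwc : HasCompactSupport fun x => |φ x| ^ p :=
    hφ.2.1.comp_left (g := fun y : ℝ => |y| ^ p) (by simp [hp0.ne'])
  have hgle : ∀ x, ‖gradient (fun x => |φ x| ^ p) x‖
      ≤ p * (|φ x| ^ (p - 1) * ‖gradient φ x‖) := fun x => by
    rw [norm_gradient, norm_gradient, ← mul_assoc]
    simpa only [← Real.norm_eq_abs] using
      norm_fderiv_norm_rpow_le (hφ1.differentiable one_ne_zero) (x := x) hp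
  have hi : Integrable (fun x => |φ x| ^ (p - 1) * ‖gradient φ x‖) (volume.restrict Ω) := by
    refine Integrable.restrict (Continuous.integrable_of_hasCompactSupport ?_ ?_)
    · have h1 := continuous_gradient hφ1
      have h2 : Continuous fun x => |φ x| ^ (p - 1) :=
        hφ1.continuous.abs.rpow_const fun x => .inr (by linarith)
      fun_prop
    · exact (hasCompactSupport_gradient hφ.2.1).norm.mul_left
  have hgi : Integrable fun x => ‖gradient (fun x => |φ x| ^ p) x‖ :=
    ((continuous_gradient hw).integrable_of_hasCompactSupport
      (hasCompactSupport_gradient hwc)).norm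
  have hg : ∫ x, ‖gradient (fun x => |φ x| ^ p) x‖
      ≤ p * (lpNorm φ (ENNReal.ofReal p) (volume.restrict Ω) ^ (p - 1)
        * lpNorm (gradient φ) (ENNReal.ofReal p) (volume.restrict Ω)) := by
    calc ∫ x, ‖gradient (fun x => |φ x| ^ p) x‖
        = ∫ x in Ω, ‖gradient (fun x => |φ x| ^ p) x‖ := by
          refine (setIntegral_eq_integral_of_forall_compl_eq_zero fun x hx => ?_).symm
          refine le_antisymm ((hgle x).trans_eq ?_) (norm_nonneg _)
          rw [hφ.eq_zero_of_notMem hx, abs_zero, Real.zero_rpow (by linarith), zero_mul, mul_zero]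
      _ ≤ ∫ x in Ω, p * (|φ x| ^ (p - 1) * ‖gradient φ x‖) :=
          integral_mono hgi.restrict (hi.const_mul p) hgle
      _ = p * ∫ x in Ω, |φ x| ^ (p - 1) * ‖gradient φ x‖ := integral_const_mul _ _
      _ ≤ _ := by
          gcongr
          exact integral_abs_rpow_mul_norm_le hp (hφ.memLp _ _) (hφ.memLp_gradient _ _)
  rw [setIntegral_eq_integral_of_forall_compl_eq_zero fun x hx => by
    rw [hφ.eq_zero_of_notMem hx, abs_zero, Real.zero_rpow hp0.ne', mul_zero]]
  calc |∫ x, a (ε⁻¹ • x) * |φ x| ^ p|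
      ≤ M * (poincareConstant N * (ε * ∫ x, ‖gradient (fun x => |φ x| ^ p) x‖)) :=
        abs_integral_rescaled_periodic_mul_le ha haM haper ha0 hε hw hwc
    _ ≤ M * (poincareConstant N * (ε * (p * (lpNorm φ (ENNReal.ofReal p) (volume.restrict Ω) ^ (p - 1)
        * lpNorm (gradient φ) (ENNReal.ofReal p) (volume.restrict Ω))))) := by gcongr
    _ = _ := by ring

end Main

end PeriodicSobolev

end

theorem mainTheorem3 (N : ℕ) (hN : 1 ≤ N) (p : ℝ) (hp : 1 < p)
    (Ω : Set (EuclideanSpace ℝ (Fin N))) (hΩ : IsOpen Ω) (hΩb : Bornology.IsBounded Ω)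
    (g : EuclideanSpace ℝ (Fin N) → ℝ) (hg : AEMeasurable g volume)
    (hgper : PeriodicSobolev.IsCubePeriodic g)
    (gm gp : ℝ) (hgm : 0 < gm) (hgb : ∀ᵐ x : EuclideanSpace ℝ (Fin N), gm ≤ g x ∧ g x ≤ gp)
    (ε : ℝ) (hε : 0 < ε)
    (u : EuclideanSpace ℝ (Fin N) → ℝ)
    (hu : PeriodicSobolev.MemW1pZero Ω (ENNReal.ofReal p) u)
    (gradu : EuclideanSpace ℝ (Fin N) → EuclideanSpace ℝ (Fin N))
    (hgradu : PeriodicSobolev.HasWeakGradient Ω u gradu) :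
    |∫ x in Ω, (g (ε⁻¹ • x) - PeriodicSobolev.cubeAverage g) * |u x| ^ p| ≤
      p * PeriodicSobolev.poincareConstant N
        * lpNorm (fun x => g x - PeriodicSobolev.cubeAverage g) ∞ volume
        * ε
        * lpNorm u (ENNReal.ofReal p) (volume.restrict Ω) ^ (p - 1)
        * lpNorm gradu (ENNReal.ofReal p) (volume.restrict Ω) := by
  open PeriodicSobolev in
  obtain ⟨hum, G, hG, hGm, φ, hφ, hφu, hφG⟩ := hu
  have hp1 : 1 ≤ ENNReal.ofReal p := by simpa using hp.le
  have hgbd : ∀ᵐ x : EuclideanSpace ℝ (Fin N), ‖g x‖ ≤ gp := by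
    filter_upwards [hgb] with x hx
    rw [Real.norm_of_nonneg (hgm.le.trans hx.1)]
    exact hx.2
  have hgi : IntegrableOn g (unitCube N) :=
    Integrable.of_bound hg.restrict.aestronglyMeasurable gp (ae_restrict_of_ae hgbd)
  set a : EuclideanSpace ℝ (Fin N) → ℝ := fun x => g x - cubeAverage g with ha
  have ham : AEMeasurable a := hg.sub_const _
  have hamem : MemLp a ∞ volume := by
    refine memLp_top_of_bound ham.aestronglyMeasurable (gp + ‖cubeAverage g‖) ?_
    filter_upwards [hgbd] with x hx
    exact (norm_sub_le _ _).trans (by gcongr)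
  have haM : ∀ᵐ x, |a x| ≤ lpNorm a ∞ volume := ae_le_lpNorm_exponent_top hamem
  have haper : IsCubePeriodic a := fun i => by
    filter_upwards [hgper i] with x hx
    simp only [ha, hx]
  have ha0 : ∫ x in unitCube N, a x = 0 := by
    rw [ha, integral_sub hgi (integrable_const _)]
    simp [cubeAverage]
  have hq := Measure.quasiMeasurePreserving_smul
    (volume : Measure (EuclideanSpace ℝ (Fin N))) (inv_pos.2 hε).ne'
  have hlhs := (tendsto_integral_mul_abs_rpow hp (b := fun x => a (ε⁻¹ • x))
    (ham.comp_quasiMeasurePreserving hq).restrict (ae_restrict_of_ae (hq.ae haM))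
    (fun n => (hφ n).memLp _ (volume.restrict Ω)) hum hφu).abs
  have hφn := tendsto_lpNorm_of_tendsto_eLpNorm_sub hp1
    (fun n => (hφ n).memLp _ (volume.restrict Ω)) hum hφu
  have hGn := tendsto_lpNorm_of_tendsto_eLpNorm_sub hp1
    (fun n => (hφ n).memLp_gradient _ (volume.restrict Ω)) hGm hφG
  -- The given weak gradient agrees almost everywhere with `G`, the limit of the gradients of `φ n`.
  rw [lpNorm_congr_ae (hgradu.ae_eq hΩ hG)]
  have hrhs := ((hφn.rpow_const (p := p - 1) (.inr (by linarith))).const_mul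
    (p * poincareConstant N * lpNorm a ∞ volume * ε)).mul hGn
  exact le_of_tendsto_of_tendsto' hlhs hrhs fun n =>
    (hφ n).abs_setIntegral_rescaled_periodic_mul_rpow_le hp ham haM haper ha0 hε
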